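/- All alphabets are finite. A morphism $\varphi\colon A^*\to B^*$ is a homomorphism of free monoids (it may send letters to the empty word). If $\varphi\colon A^*\to A^*$ is a morphism and $a\in A$ is a letter such that $\varphi(a)=au$ for some word $u\in A^*$ with $\varphi^k(u)$ non-empty for all $k\ge 0$, then $\varphi^\infty(a)$ denotes the right-infinite word $a\,u\,\varphi(u)\,\varphi^2(u)\,\varphi^3(u)\cdots$. A morphism $h\colon A^*\to B^*$ is applied to an infinite word letter by letter. A morphism $\rho\colon D^*\to D^*$ is primitive if for some $k\ge 1$ every letter of $D$ occurs in $\rho^k(c)$ for every letter $c\in D$. A right-infinite word $W$ is periodic if for some $k\ge 1$ one has $W[i+k]=W[i]$ for all $i$, and it is uniformly recurrent if for every finite factor $v$ of $W$ there is a number $k$ such that $v$ occurs in every factor of $W$ of length at least $k$. Lemma. Let $\varphi\colon A^*\to A^*$ and $h\colon A^*\to B^*$ be arbitrary morphisms and let $a\in A$ be a letter for which $\varphi^\infty(a)$ is defined and $W=h(\varphi^\infty(a))$ is an infinite word. If $W$ is uniformly recurrent and not periodic, then there exist a finite alphabet $D$, a primitive morphism $\rho\colon D^*\to D^*$, a morphism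 $g\colon D^*\to B^*$ and a letter $d\in D$ such that $\rho^\infty(d)$ is defined, $g(\rho^\infty(d))$ is an infinite word, and $g(\rho^\infty(d))$ and $W$ have the same set of finite factors. -/

import Mathlib

/-! Finite words over an alphabet `A` are elements of the free monoid `FreeMonoid A`, right-infinite
words are functions `ℕ → A`, and morphisms are monoid homomorphisms between free monoids
(letters may be erased). -/

namespace MorphicWords

/-- The finite word `X[i] X[i+1] … X[i+n-1]` of length `n`. -/
def block {A : Type*} (X : ℕ → A) (i n : ℕ) : List A :=
  (List.range n).map (fun j => X (i + j))

/-- The set of finite factors (subwords) of the infinite word `X`. -/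
def factors {A : Type*} (X : ℕ → A) : Set (FreeMonoid A) :=
  {v | ∃ i n : ℕ, v.toList = block X i n}

/-- Every factor `v` of `X` occurs in every sufficiently long factor of `X`. -/
def UniformlyRecurrent {A : Type*} (X : ℕ → A) : Prop :=
  ∀ v ∈ factors X, ∃ k : ℕ, ∀ u ∈ factors X, k ≤ u.toList.length → v.toList <:+: u.toList

/-- `X[i + k] = X[i]` for all `i`, for some period `k ≥ 1`. -/
def IsPeriodic {A : Type*} (X : ℕ → A) : Prop :=
  ∃ k : ℕ, 1 ≤ k ∧ Function.Periodic X k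

/-- The finite word `w 0 * w 1 * ⋯ * w (n - 1)`. -/
def partialConcat {A : Type*} (w : ℕ → FreeMonoid A) (n : ℕ) : FreeMonoid A :=
  ((List.range n).map w).prod

/-- `X` is the infinite concatenation `w 0 * w 1 * w 2 * ⋯`, which is an infinite word: all the
partial concatenations are prefixes of `X` and their lengths are unbounded. -/
def IsConcat {A : Type*} (w : ℕ → FreeMonoid A) (X : ℕ → A) : Prop :=
  (∀ n : ℕ, (partialConcat w n).toList = block X 0 (partialConcat w n).toList.length) ∧
    ∀ N : ℕ, ∃ n : ℕ, N ≤ (partialConcat w n).toList.length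

/-- `W = h(X)`: the infinite word `W` is `h(X[0]) h(X[1]) h(X[2]) ⋯`. -/
def IsImage {A B : Type*} (h : FreeMonoid A →* FreeMonoid B) (X : ℕ → A) (W : ℕ → B) : Prop :=
  IsConcat (fun i => h (FreeMonoid.of (X i))) W

/-- `X = φ^∞(a)`: one has `φ(a) = a u`, no `φ^k(u)` is the empty word, and
`X = a u φ(u) φ²(u) φ³(u) ⋯`. -/
def IsPureMorphic {A : Type*} (φ : FreeMonoid A →* FreeMonoid A) (a : A) (X : ℕ → A) : Prop :=
  ∃ u : FreeMonoid A, φ (FreeMonoid.of a) = FreeMonoid.of a * u ∧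
    (∀ k : ℕ, (⇑φ)^[k] u ≠ 1) ∧
    IsConcat (fun i => Nat.casesOn i (FreeMonoid.of a) (fun k => (⇑φ)^[k] u)) X

/-- For some power `φ^k`, `k ≥ 1`, every letter occurs in the image of every letter. -/
def IsPrimitive {A : Type*} (φ : FreeMonoid A →* FreeMonoid A) : Prop :=
  ∃ k : ℕ, 1 ≤ k ∧ ∀ b c : A, b ∈ ((⇑φ)^[k] (FreeMonoid.of c)).toList

end MorphicWords

namespace MorphicWords

open FreeMonoid

/-! Let `L` be the set of factors of `W`. Since `W` is uniformly recurrent and not periodic, `L`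
cannot contain all powers of a nonempty word (`powerFree_factors`). Uniform recurrence also gives
that an infinite word generated with all coded iterates inside `L` has exactly `L` as its set of
factors (`factors_eq_of_stays`). So it suffices to find a primitive prolongable morphism whose coded
iterates stay in `L` and grow. When every letter of a finite alphabet grows, a terminal component of
a suitable power provides one (`exists_primitive_of_grows`). The difficulty is the letters that do
not grow.

Letters that are eventually erased are deleted, after which each letter grows or has a finite orbit
(`exists_finite_orbit_or_grows`); in a suitable power the latter become words over fixed letters
(`exists_isGrowing`). If a growing letter `s` has an image beginning `v s` or ending `s v` with `v`
a fixed word, iteration puts all powers of `v` in `L`, so `v` is empty (`head_eq_one`,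
`tail_eq_one`). Hence leading fixed words can be conjugated away and trailing ones do not
accumulate. A growing letter together with the fixed word after it then ranges over a finite set of
blocks; with these as letters, every letter grows (`IsGrowing.exists_primitive`). -/

theorem mem_iff_exists_factorization {A : Type*} {c : A} {w : FreeMonoid A} :
    c ∈ w ↔ ∃ x y, w = x * of c * y := by
  constructor
  · intro hc
    obtain ⟨s, t, hst⟩ := List.append_of_mem (show c ∈ w.toList from hc)
    refine ⟨ofList s, ofList t, ?_⟩
    rw [mul_assoc]
    exact hst
  · rintro ⟨x, y, rfl⟩
    simp [mem_mul]

theorem mem_hom_iff {A B : Type*} (f : FreeMonoid A →* FreeMonoid B) {d : B} {w : FreeMonoid A} :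
    d ∈ f w ↔ ∃ c ∈ w, d ∈ f (of c) := by
  induction w using FreeMonoid.inductionOn' with
  | one => simp [notMem_one]
  | of_mul c w ih => simp [mem_mul, ih, or_and_right, exists_or]

theorem hom_eq_one_iff {A B : Type*} (f : FreeMonoid A →* FreeMonoid B) {w : FreeMonoid A} :
    f w = 1 ↔ ∀ c ∈ w, f (of c) = 1 := by
  induction w using FreeMonoid.inductionOn' with
  | one => simp [notMem_one]
  | of_mul c w ih =>
    have h : ∀ x y : FreeMonoid B, x * y = 1 ↔ x = 1 ∧ y = 1 := by
      intro x y
      rw [← length_eq_zero, ← length_eq_zero, ← length_eq_zero, length_mul]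
      omega
    rw [map_mul, h, ih]
    simp [mem_mul, or_imp, forall_and]

theorem ne_one_iff_exists_mem {A : Type*} {w : FreeMonoid A} : w ≠ 1 ↔ ∃ c, c ∈ w := by
  induction w using FreeMonoid.inductionOn' with
  | one => simp [notMem_one]
  | of_mul c w ih =>
    refine ⟨fun _ => ⟨c, by simp [mem_mul]⟩, fun _ h => ?_⟩
    have := congrArg length h
    rw [length_mul, length_of, length_one] at this
    omega

/-- The iterate `φ^n` of an endomorphism, as a morphism. -/
def power {A : Type*} (φ : FreeMonoid A →* FreeMonoid A) (n : ℕ) : FreeMonoid A →* FreeMonoid A :=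
  (show Monoid.End (FreeMonoid A) from φ) ^ n

theorem coe_power {A : Type*} (φ : FreeMonoid A →* FreeMonoid A) (n : ℕ) :
    ⇑(power φ n) = φ^[n] := rfl

theorem power_iterate {A : Type*} (φ : FreeMonoid A →* FreeMonoid A) (p n : ℕ) :
    (power φ p)^[n] = φ^[p * n] := by
  rw [coe_power, Function.iterate_mul]

theorem iterate_mul {A : Type*} (φ : FreeMonoid A →* FreeMonoid A) (n : ℕ) (x y : FreeMonoid A) :
    φ^[n] (x * y) = φ^[n] x * φ^[n] y :=
  map_mul (power φ n) x y

theorem iterate_one {A : Type*} (φ : FreeMonoid A →* FreeMonoid A) (n : ℕ) :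
    φ^[n] 1 = 1 :=
  map_one (power φ n)

/-! ### Orbits of words relative to a language -/

/-- A set of words closed under taking factors. -/
def FactorClosed {B : Type*} (L : Set (FreeMonoid B)) : Prop :=
  ∀ x y z, x * y * z ∈ L → y ∈ L

/-- No nonempty word has all its powers in `L`. -/
def PowerFree {B : Type*} (L : Set (FreeMonoid B)) : Prop :=
  ∀ v, (∀ n : ℕ, v ^ n ∈ L) → v = 1

/-- All the words `h (φ^n w)` lie in `L`. -/
def Stays {A B : Type*} (L : Set (FreeMonoid B)) (φ : FreeMonoid A →* FreeMonoid A)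
    (h : FreeMonoid A →* FreeMonoid B) (w : FreeMonoid A) : Prop :=
  ∀ n, h (φ^[n] w) ∈ L

/-- The lengths of the words `h (φ^n w)` tend to infinity. -/
def Grows {A B : Type*} (φ : FreeMonoid A →* FreeMonoid A)
    (h : FreeMonoid A →* FreeMonoid B) (w : FreeMonoid A) : Prop :=
  ∀ N, ∃ n₀, ∀ n ≥ n₀, N ≤ (h (φ^[n] w)).length

section

variable {A B : Type*} {L : Set (FreeMonoid B)} {φ : FreeMonoid A →* FreeMonoid A}
  {h : FreeMonoid A →* FreeMonoid B}

theorem Stays.factor (hL : FactorClosed L) {x y z : FreeMonoid A} (hs : Stays L φ h (x * y * z)) :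
    Stays L φ h y := by
  intro n
  have := hs n
  rw [iterate_mul, iterate_mul, map_mul, map_mul] at this
  exact hL _ _ _ this

theorem Stays.of_mem (hL : FactorClosed L) {w : FreeMonoid A} (hs : Stays L φ h w) {c : A}
    (hc : c ∈ w) : Stays L φ h (of c) := by
  obtain ⟨x, y, rfl⟩ := mem_iff_exists_factorization.1 hc
  exact hs.factor hL

theorem Stays.iterate {w : FreeMonoid A} (hs : Stays L φ h w) (m : ℕ) :
    Stays L φ h (φ^[m] w) := by
  intro n
  rw [← Function.iterate_add_apply]
  exact hs _

theorem Stays.power {w : FreeMonoid A} (hs : Stays L φ h w) (p : ℕ) :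
    Stays L (power φ p) h w := by
  intro n
  rw [power_iterate]
  exact hs _

theorem Grows.power {w : FreeMonoid A} (hs : Grows φ h w) {p : ℕ} (hp : 1 ≤ p) :
    Grows (power φ p) h w := by
  intro N
  obtain ⟨n₀, hn⟩ := hs N
  refine ⟨n₀, fun n hn' => ?_⟩
  rw [power_iterate]
  exact hn _ (hn'.le.trans (Nat.le_mul_of_pos_left n hp))

theorem Grows.factor {x y z : FreeMonoid A} (hs : Grows φ h y) : Grows φ h (x * y * z) := by
  intro N
  obtain ⟨n₀, hn⟩ := hs N
  refine ⟨n₀, fun n hn' => ?_⟩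
  have := hn n hn'
  rw [iterate_mul, iterate_mul, map_mul, map_mul, length_mul, length_mul]
  omega

theorem Grows.of_mem {w : FreeMonoid A} {c : A} (hc : c ∈ w) (hs : Grows φ h (of c)) :
    Grows φ h w := by
  obtain ⟨x, y, rfl⟩ := mem_iff_exists_factorization.1 hc
  exact hs.factor

theorem Grows.not_eventually_constant {w : FreeMonoid A} (hs : Grows φ h w) (m : ℕ)
    (v : FreeMonoid A) (hc : ∀ n ≥ m, φ^[n] w = v) : False := by
  obtain ⟨n₀, hn⟩ := hs ((h v).length + 1)
  have := hn (max m n₀) (le_max_right _ _)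
  rw [hc _ (le_max_left _ _)] at this
  omega

end

/-! ### Idempotent iterates and restriction of the alphabet -/

/-- A finite orbit contains a point from which the map is idempotent. -/
theorem exists_iterate_idempotent {α : Type*} (f : α → α) (x : α)
    (hfin : (Set.range fun n => f^[n] x).Finite) :
    ∃ p, 1 ≤ p ∧ f^[p] (f^[p] x) = f^[p] x := by
  obtain ⟨i, j, hij, he⟩ : ∃ i j : ℕ, i < j ∧ f^[i] x = f^[j] x := by
    by_contra! hne
    refine Set.infinite_range_of_injective (f := fun n => f^[n] x) ?_ hfin
    intro i j he
    rcases lt_trichotomy i j with hlt | rfl | hlt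
    · exact absurd he (hne i j hlt)
    · rfl
    · exact absurd he.symm (hne j i hlt)
  obtain ⟨q, rfl⟩ := Nat.exists_eq_add_of_lt hij
  have hper : ∀ m ≥ i, f^[m + (q + 1)] x = f^[m] x := by
    intro m hm
    obtain ⟨r, rfl⟩ := Nat.exists_eq_add_of_le' hm
    rw [add_assoc, Function.iterate_add_apply, ← add_assoc, ← he, ← Function.iterate_add_apply]
  have hper' : ∀ k, ∀ m ≥ i, f^[m + (q + 1) * k] x = f^[m] x := by
    intro k
    induction k with
    | zero => simp
    | succ k ih =>
      intro m hm
      rw [mul_add, mul_one, ← add_assoc, hper _ (by omega), ih m hm]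
  -- A multiple of the period `q + 1` that is at least the preperiod `i`.
  refine ⟨(q + 1) * (i + 1), by nlinarith, ?_⟩
  rw [← Function.iterate_add_apply]
  exact hper' _ _ (by nlinarith)

/-- The restriction of a morphism to a finite set of letters closed under it. -/
theorem exists_restriction {A : Type*} (φ : FreeMonoid A →* FreeMonoid A) (F : Set A)
    (hF : F.Finite) (hcl : ∀ c ∈ F, ∀ d ∈ φ (of c), d ∈ F) :
    ∃ (n : ℕ) (i : Fin n → A) (ρ : FreeMonoid (Fin n) →* FreeMonoid (Fin n)),
      Set.range i = F ∧ Function.Injective i ∧ ∀ w, φ (map i w) = map i (ρ w) := by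
  -- Indexing by `Fin n` puts the new alphabet in `Type`, whatever the universe of `A`.
  obtain ⟨n, i, hinj, hr⟩ := hF.fin_param
  have hlift : ∀ w : FreeMonoid A, (∀ c ∈ w, c ∈ F) → ∃ v, map i v = w := by
    intro w
    induction w using FreeMonoid.inductionOn' with
    | one => exact fun _ => ⟨1, map_one _⟩
    | of_mul c w ih =>
      intro hw
      obtain ⟨v, rfl⟩ := ih fun c hc => hw c (mem_mul.2 (Or.inr hc))
      obtain ⟨k, hk⟩ : c ∈ Set.range i := hr ▸ hw c (mem_mul.2 (Or.inl mem_of_self))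
      exact ⟨of k * v, by rw [map_mul, map_of, hk]⟩
  have hex : ∀ k, ∃ v, map i v = φ (of (i k)) := fun k =>
    hlift _ (hcl _ (hr ▸ Set.mem_range_self k))
  choose r hr' using hex
  refine ⟨n, i, lift r, hr, hinj, fun w => ?_⟩
  have : φ.comp (map i) = (map i).comp (lift r) := hom_eq fun k => by simp [hr']
  exact DFunLike.congr_fun this w

theorem semiconj_iterate {A A' : Type*} {φ : FreeMonoid A →* FreeMonoid A}
    {ψ : FreeMonoid A' →* FreeMonoid A'} {τ : FreeMonoid A →* FreeMonoid A'}
    (hτ : ∀ w, ψ (τ w) = τ (φ w)) (n : ℕ) (w : FreeMonoid A) :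
    ψ^[n] (τ w) = τ (φ^[n] w) :=
  ((Function.Semiconj.iterate_right (f := τ) (ga := φ) (gb := ψ) (fun w => (hτ w).symm) n) w).symm

/-! ### Infinite words, their factors and their generation -/

section Words

variable {A B : Type*}

theorem length_block (X : ℕ → A) (i n : ℕ) : (block X i n).length = n := by
  simp [block]

theorem block_add (X : ℕ → A) (i m n : ℕ) :
    block X i (m + n) = block X i m ++ block X (i + m) n := by
  simp [block, List.range_add, add_assoc]

theorem getElem?_block (X : ℕ → A) {i n j : ℕ} (hj : j < n) :
    (block X i n)[j]? = some (X (i + j)) := by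
  simp [block, hj]

theorem ofList_block_mem_factors (X : ℕ → A) (i n : ℕ) : ofList (block X i n) ∈ factors X :=
  ⟨i, n, rfl⟩

theorem eq_block_of_append {X : ℕ → A} {i n : ℕ} {x y : List A} (hxy : x ++ y = block X i n) :
    x = block X i x.length ∧ y = block X (i + x.length) y.length := by
  have hl := congrArg List.length hxy
  rw [List.length_append, length_block] at hl
  rw [← hl, block_add] at hxy
  exact List.append_inj hxy (length_block ..).symm

theorem factorClosed_factors (X : ℕ → A) : FactorClosed (factors X) := by
  rintro x y z ⟨i, n, h⟩
  have h1 := (eq_block_of_append (x := (x * y).toList) (y := z.toList) h).1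
  have h2 := (eq_block_of_append (x := x.toList) (y := y.toList) h1).2
  exact ⟨_, _, h2⟩

theorem partialConcat_succ (w : ℕ → FreeMonoid A) (n : ℕ) :
    partialConcat w (n + 1) = partialConcat w n * w n := by
  simp [partialConcat, List.range_succ]

theorem partialConcat_hom (f : FreeMonoid A →* FreeMonoid B) (X : ℕ → A) (n : ℕ) :
    partialConcat (fun i => f (of (X i))) n = f (ofList (block X 0 n)) := by
  induction n with
  | zero => exact (map_one f).symm
  | succ n ih =>
    rw [partialConcat_succ, ih, block_add, ofList_append, map_mul]
    simp [block]

theorem length_partialConcat_mono (w : ℕ → FreeMonoid A) :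
    Monotone fun n => (partialConcat w n).length :=
  monotone_nat_of_le_succ fun n => by
    rw [partialConcat_succ, length_mul]
    omega

theorem partialConcat_iterate {φ : FreeMonoid A →* FreeMonoid A} {a : A} {u : FreeMonoid A}
    (hu : φ (of a) = of a * u) (n : ℕ) :
    partialConcat (fun i => Nat.casesOn i (of a) fun k => (⇑φ)^[k] u) (n + 1) = φ^[n] (of a) := by
  induction n with
  | zero => simp [partialConcat]
  | succ n ih =>
    rw [partialConcat_succ, ih, Function.iterate_succ_apply, hu, iterate_mul]

theorem IsPureMorphic.iterate_eq_block {φ : FreeMonoid A →* FreeMonoid A} {a : A} {X : ℕ → A}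
    (hX : IsPureMorphic φ a X) (n : ℕ) :
    φ^[n] (of a) = ofList (block X 0 (φ^[n] (of a)).length) := by
  obtain ⟨u, hu, -, hc, -⟩ := hX
  rw [← partialConcat_iterate hu]
  exact hc _

theorem IsPureMorphic.exists_le_length {φ : FreeMonoid A →* FreeMonoid A} {a : A} {X : ℕ → A}
    (hX : IsPureMorphic φ a X) (N : ℕ) : ∃ n₀, ∀ n ≥ n₀, N ≤ (φ^[n] (of a)).length := by
  obtain ⟨u, hu, -, -, hl⟩ := hX
  obtain ⟨n₀, hn⟩ := hl N
  refine ⟨n₀, fun n hn' => ?_⟩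
  rw [← partialConcat_iterate hu]
  exact hn.trans (length_partialConcat_mono _ (by omega))

theorem IsImage.hom_block {h : FreeMonoid A →* FreeMonoid B} {X : ℕ → A} {W : ℕ → B}
    (hW : IsImage h X W) (n : ℕ) :
    h (ofList (block X 0 n)) = ofList (block W 0 (h (ofList (block X 0 n))).length) := by
  rw [← partialConcat_hom]
  exact hW.1 n

theorem IsImage.exists_le_length {h : FreeMonoid A →* FreeMonoid B} {X : ℕ → A} {W : ℕ → B}
    (hW : IsImage h X W) (N : ℕ) : ∃ n₀, ∀ n ≥ n₀, N ≤ (h (ofList (block X 0 n))).length := by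
  obtain ⟨n₀, hn⟩ := hW.2 N
  refine ⟨n₀, fun n hn' => ?_⟩
  rw [← partialConcat_hom]
  exact hn.trans (length_partialConcat_mono _ hn')

theorem stays_factors {φ : FreeMonoid A →* FreeMonoid A} {h : FreeMonoid A →* FreeMonoid B}
    {a : A} {X : ℕ → A} {W : ℕ → B} (hX : IsPureMorphic φ a X) (hW : IsImage h X W) :
    Stays (factors W) φ h (of a) := by
  intro n
  rw [hX.iterate_eq_block, hW.hom_block]
  exact ofList_block_mem_factors _ _ _

theorem grows_of_isImage {φ : FreeMonoid A →* FreeMonoid A} {h : FreeMonoid A →* FreeMonoid B}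
    {a : A} {X : ℕ → A} {W : ℕ → B} (hX : IsPureMorphic φ a X) (hW : IsImage h X W) :
    Grows φ h (of a) := by
  intro N
  obtain ⟨m, hm⟩ := hW.exists_le_length N
  obtain ⟨n₀, hn⟩ := hX.exists_le_length m
  refine ⟨n₀, fun n hn' => ?_⟩
  rw [hX.iterate_eq_block]
  exact hm _ (hn n hn')

theorem length_pow (v : FreeMonoid A) (n : ℕ) : (v ^ n).length = n * v.length := by
  induction n with
  | zero => simp
  | succ n ih => rw [pow_succ, length_mul, ih]; ring

/-- A uniformly recurrent word having all powers of a nonempty word as factors is periodic. -/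
theorem powerFree_factors {W : ℕ → B} (hrec : UniformlyRecurrent W) (hper : ¬ IsPeriodic W) :
    PowerFree (factors W) := by
  intro v hv
  by_contra hne
  have hk : 1 ≤ v.length := Nat.one_le_iff_ne_zero.2 fun h => hne (length_eq_zero.1 h)
  refine hper ⟨v.length, hk, fun i => ?_⟩
  -- The block of length `|v| + 1` at `i` occurs in a power of `v`, which has period `|v|`;
  -- comparing its first and last letters gives `W i = W (i + |v|)`.
  obtain ⟨N, hN⟩ := hrec _ (ofList_block_mem_factors W i (v.length + 1))
  obtain ⟨x, y, hxy⟩ := hN _ (hv (N + 1)) (show N ≤ (v ^ (N + 1)).length by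
    rw [length_pow]; nlinarith)
  rw [toList_ofList] at hxy
  have hlen : x.length + (v.length + 1) + y.length = N * v.length + v.length := by
    have := congrArg List.length hxy
    rw [List.length_append, List.length_append, length_block] at this
    rw [this]
    change (v ^ (N + 1)).length = _
    rw [length_pow]; ring
  have hget : ∀ j < v.length + 1, (v ^ (N + 1)).toList[x.length + j]? = some (W (i + j)) := by
    intro j hj
    rw [← hxy, List.append_assoc, List.getElem?_append_right (by omega),
      List.getElem?_append_left (by rw [length_block]; omega), Nat.add_sub_cancel_left,
      getElem?_block _ hj]
  have h0 := hget 0 (by omega)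
  have h1 := hget v.length (by omega)
  -- Splitting the power as `v ^ N * v` and as `v * v ^ N` reads both letters at the same position
  -- of `v ^ N`.
  rw [pow_succ, toList_mul, List.getElem?_append_left (by
    change _ < (v ^ N).length
    rw [length_pow]; omega)] at h0
  rw [pow_succ', toList_mul, List.getElem?_append_right (by
    change v.length ≤ _; omega)] at h1
  have : x.length + v.length - v.toList.length = x.length + 0 := by
    change _ - v.length = _; omega
  rw [this, h0] at h1
  simpa using h1.symm

/-- Finite words of unbounded lengths, each a prefix of the next, have a limit. -/
theorem exists_isConcat (w : ℕ → FreeMonoid A)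
    (hw : ∀ N, ∃ n, N ≤ (partialConcat w n).length) : ∃ X, IsConcat w X := by
  choose m hm using fun N => hw (N + 1)
  have hpre : ∀ i j, i ≤ j → (partialConcat w i).toList <+: (partialConcat w j).toList := by
    intro i j hij
    induction j, hij using Nat.le_induction with
    | base => exact List.prefix_rfl
    | succ j _ ih =>
      rw [partialConcat_succ, toList_mul]
      exact ih.trans (List.prefix_append _ _)
  refine ⟨fun N => (partialConcat w (m N)).toList[N]'(hm N), fun n => ?_, hw⟩
  refine List.ext_getElem (by rw [length_block]) fun j h1 h2 => ?_
  simp only [block, List.getElem_map, List.getElem_range]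
  simp only [Nat.zero_add]
  rcases le_total n (m j) with h | h
  · exact (hpre _ _ h).getElem h1
  · exact ((hpre _ _ h).getElem (hm j)).symm

/-- The limit word of a morphism prolongable on a letter. -/
theorem exists_isPureMorphic {φ : FreeMonoid A →* FreeMonoid A} {h : FreeMonoid A →* FreeMonoid B}
    {a : A} {u : FreeMonoid A} (hu : φ (of a) = of a * u) (hg : Grows φ h (of a)) :
    ∃ (X : ℕ → A) (W : ℕ → B), IsPureMorphic φ a X ∧ IsImage h X W := by
  -- If `φ^k(u)` were empty, `φ^n(a)` would be constant from `n = k` on, against growth.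
  have hne : ∀ k : ℕ, (⇑φ)^[k] u ≠ 1 := by
    intro k hk
    refine hg.not_eventually_constant k (φ^[k] (of a)) fun n hn => ?_
    induction n, hn using Nat.le_induction with
    | base => rfl
    | succ n hn ih =>
      obtain ⟨r, rfl⟩ := Nat.exists_eq_add_of_le' hn
      rw [Function.iterate_succ_apply, hu, iterate_mul, ih, Function.iterate_add_apply φ r k, hk,
        iterate_one, mul_one]
  obtain ⟨X, hX⟩ := exists_isConcat
    (fun i => Nat.casesOn i (FreeMonoid.of a) (fun k => (⇑φ)^[k] u) : ℕ → FreeMonoid A) (by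
      intro N
      refine ⟨N + 1, ?_⟩
      rw [partialConcat_iterate hu]
      induction N with
      | zero => omega
      | succ n ih =>
        rw [Function.iterate_succ_apply, hu, iterate_mul, length_mul]
        have : (φ^[n] u).length ≠ 0 := fun h0 => hne n (length_eq_zero.1 h0)
        omega)
  have hX' : IsPureMorphic φ a X := ⟨u, hu, hne, hX⟩
  obtain ⟨W, hW⟩ := exists_isConcat (fun i => h (of (X i))) (by
    intro N
    obtain ⟨n, hn⟩ := hg N
    refine ⟨(φ^[n] (of a)).length, ?_⟩
    rw [partialConcat_hom, ← hX'.iterate_eq_block]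
    exact hn n le_rfl)
  exact ⟨X, W, hX', hW⟩

/-- An infinite word generated inside the language of a uniformly recurrent word has the same
factors. -/
theorem factors_eq_of_stays {D : Type*} {ρ : FreeMonoid D →* FreeMonoid D}
    {g : FreeMonoid D →* FreeMonoid B} {d : D} {Y : ℕ → D} {V W : ℕ → B}
    (hrec : UniformlyRecurrent W) (hY : IsPureMorphic ρ d Y) (hV : IsImage g Y V)
    (hs : Stays (factors W) ρ g (of d)) : factors V = factors W := by
  have hg := grows_of_isImage hY hV
  have hpre : ∀ n, g (ρ^[n] (of d)) = ofList (block V 0 (g (ρ^[n] (of d))).length) := by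
    intro n
    rw [hY.iterate_eq_block]
    exact hV.hom_block _
  ext v
  constructor
  · rintro ⟨i, n, hv⟩
    obtain ⟨m, hm⟩ := hg (i + n)
    have h1 := hs m
    obtain ⟨r, hr⟩ := Nat.exists_eq_add_of_le (hm m le_rfl)
    rw [hpre m, hr, block_add, block_add, ofList_append, ofList_append, zero_add, ← hv] at h1
    exact factorClosed_factors W _ _ _ h1
  · intro hv
    obtain ⟨k, hk⟩ := hrec v hv
    obtain ⟨m, hm⟩ := hg k
    obtain ⟨x, y, hxy⟩ := hk _ (hs m) (hm m le_rfl)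
    have h1 := ofList_block_mem_factors V 0 (g (ρ^[m] (of d))).length
    rw [← hpre m] at h1
    exact factorClosed_factors V (ofList x) v (ofList y) (by
      rwa [show ofList x * v * ofList y = g (ρ^[m] (of d)) from hxy])

end Words

section Semiconj

variable {A A' B : Type*} {L : Set (FreeMonoid B)} {φ : FreeMonoid A →* FreeMonoid A}
  {ψ : FreeMonoid A' →* FreeMonoid A'} {τ : FreeMonoid A →* FreeMonoid A'}

/-- Restriction, replacement of letters, conjugation and block coding are all maps `τ` intertwining
two morphisms; staying in `L` and growth pass along them. -/
theorem stays_comp_iff (hτ : ∀ w, ψ (τ w) = τ (φ w)) (h : FreeMonoid A' →* FreeMonoid B)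
    (w : FreeMonoid A) : Stays L φ (h.comp τ) w ↔ Stays L ψ h (τ w) := by
  simp only [Stays, semiconj_iterate hτ, MonoidHom.comp_apply]

theorem grows_comp_iff (hτ : ∀ w, ψ (τ w) = τ (φ w)) (h : FreeMonoid A' →* FreeMonoid B)
    (w : FreeMonoid A) : Grows φ (h.comp τ) w ↔ Grows ψ h (τ w) := by
  simp only [Grows, semiconj_iterate hτ, MonoidHom.comp_apply]

end Semiconj

/-! ### Primitive morphisms from growing letters -/

/-- Some power of a morphism has an idempotent incidence relation. -/
theorem exists_power_mem_idempotent {A : Type*} [Finite A] (φ : FreeMonoid A →* FreeMonoid A) :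
    ∃ p, 1 ≤ p ∧ ∀ c d, d ∈ power φ p (power φ p (of c)) ↔ d ∈ power φ p (of c) := by
  -- Composition with the incidence relation of `φ`, iterated from the identity relation. There are
  -- finitely many relations, so the orbit is finite.
  let f : (A → Set A) → (A → Set A) := fun S c => {d | ∃ e ∈ S c, d ∈ φ (of e)}
  have hf : ∀ n c, (f^[n] fun c => {c}) c = {d | d ∈ φ^[n] (of c)} := by
    intro n
    induction n with
    | zero => intro c; ext d; simp [mem_of]
    | succ n ih =>
      intro c
      ext d
      rw [Function.iterate_succ_apply', Function.iterate_succ_apply']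
      change (∃ e ∈ f^[n] (fun c => {c}) c, d ∈ φ (of e)) ↔ d ∈ φ (φ^[n] (of c))
      rw [mem_hom_iff, ih]
      rfl
  obtain ⟨p, hp, he⟩ := exists_iterate_idempotent f (fun c => {c}) (Set.toFinite _)
  refine ⟨p, hp, fun c d => ?_⟩
  have h1 := congrFun he c
  rw [← Function.iterate_add_apply, hf, hf] at h1
  rw [coe_power, ← Function.iterate_add_apply]
  exact Set.ext_iff.1 h1 d

theorem mem_power_of_forall_mem {A : Type*} {φ : FreeMonoid A →* FreeMonoid A}
    (hφ : ∀ b c, b ∈ φ (of c)) {p : ℕ} (hp : 1 ≤ p) (b c : A) : b ∈ φ^[p] (of c) := by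
  induction p, hp using Nat.le_induction generalizing b c with
  | base => exact hφ b c
  | succ p _ ih =>
    rw [Function.iterate_succ_apply', mem_hom_iff]
    exact ⟨b, ih b c, hφ b b⟩

theorem Grows.ne_one {A B : Type*} {φ : FreeMonoid A →* FreeMonoid A}
    {h : FreeMonoid A →* FreeMonoid B} {w : FreeMonoid A} (hw : Grows φ h w) : φ w ≠ 1 := by
  intro h1
  refine hw.not_eventually_constant 1 1 fun n hn => ?_
  obtain ⟨r, rfl⟩ := Nat.exists_eq_add_of_le' hn
  rw [Function.iterate_succ_apply, h1, iterate_one]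

theorem exists_eq_of_mul {A : Type*} {w : FreeMonoid A} (hw : w ≠ 1) : ∃ c u, w = of c * u := by
  cases w with
  | one => exact absurd rfl hw
  | of_mul c u => exact ⟨c, u, rfl⟩

/-- Some power of a morphism whose letters have nonempty images is prolongable on some letter. -/
theorem exists_power_prolongable {A : Type*} [Finite A] [Nonempty A]
    {φ : FreeMonoid A →* FreeMonoid A} (hφ : ∀ c, φ (of c) ≠ 1) :
    ∃ p, 1 ≤ p ∧ ∃ a u, power φ p (of a) = of a * u := by
  -- `f` is the first-letter map; a letter fixed by a power of `f` is one on which that power of `φ`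
  -- is prolongable.
  choose f u hu using fun c => exists_eq_of_mul (hφ c)
  have hf : ∀ n c, ∃ v, φ^[n] (of c) = of (f^[n] c) * v := by
    intro n
    induction n with
    | zero => exact fun c => ⟨1, by simp⟩
    | succ n ih =>
      intro c
      obtain ⟨v, hv⟩ := ih c
      exact ⟨u (f^[n] c) * φ v, by
        rw [Function.iterate_succ_apply', hv, map_mul, hu, Function.iterate_succ_apply', mul_assoc]⟩
  obtain ⟨p, hp, he⟩ := exists_iterate_idempotent f (Classical.arbitrary A) (Set.toFinite _)
  obtain ⟨v, hv⟩ := hf p (f^[p] (Classical.arbitrary A))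
  exact ⟨p, hp, _, v, by rw [coe_power, hv, he]⟩

/-- A morphism all of whose letters grow contains a primitive morphism in one of its powers. -/
theorem exists_primitive_of_grows {A B : Type*} {L : Set (FreeMonoid B)}
    (φ : FreeMonoid A →* FreeMonoid A) (h : FreeMonoid A →* FreeMonoid B) (F : Set A)
    (hF : F.Finite) (hne : F.Nonempty) (hcl : ∀ c ∈ F, ∀ d ∈ φ (of c), d ∈ F)
    (hs : ∀ c ∈ F, Stays L φ h (of c)) (hg : ∀ c ∈ F, Grows φ h (of c)) :
    ∃ (n : ℕ) (ρ : FreeMonoid (Fin n) →* FreeMonoid (Fin n))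
      (g : FreeMonoid (Fin n) →* FreeMonoid B) (d : Fin n) (u : FreeMonoid (Fin n)),
      IsPrimitive ρ ∧ ρ (of d) = of d * u ∧ Stays L ρ g (of d) ∧ Grows ρ g (of d) := by
  obtain ⟨n₁, i₁, ρ₁, hr₁, -, hρ₁⟩ := exists_restriction φ F hF hcl
  have hs₁ : ∀ k, Stays L ρ₁ (h.comp (map i₁)) (of k) := fun k =>
    (stays_comp_iff hρ₁ h _).2 (hs _ (hr₁ ▸ Set.mem_range_self k))
  have hg₁ : ∀ k, Grows ρ₁ (h.comp (map i₁)) (of k) := fun k =>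
    (grows_comp_iff hρ₁ h _).2 (hg _ (hr₁ ▸ Set.mem_range_self k))
  have : Nonempty (Fin n₁) := by
    obtain ⟨c, hc⟩ := hne
    rw [← hr₁] at hc
    exact ⟨hc.choose⟩
  obtain ⟨p, hp, hidem⟩ := exists_power_mem_idempotent ρ₁
  -- Take `c` whose image has the fewest distinct letters. Idempotence puts the letters of the image
  -- of any `d` below `c` among those of `c`; minimality makes the two sets equal.
  obtain ⟨c, hmin⟩ := Finite.exists_min fun c => {d | d ∈ power ρ₁ p (of c)}.ncard
  have hsub : ∀ d ∈ power ρ₁ p (of c), ∀ e ∈ power ρ₁ p (of d), e ∈ power ρ₁ p (of c) :=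
    fun d hd e he => (hidem c e).1 ((mem_hom_iff _).2 ⟨d, hd, he⟩)
  have heq : ∀ d ∈ power ρ₁ p (of c), ∀ e ∈ power ρ₁ p (of c), e ∈ power ρ₁ p (of d) := by
    intro d hd e he
    have := Set.eq_of_subset_of_ncard_le (s := {e | e ∈ power ρ₁ p (of d)})
      (t := {e | e ∈ power ρ₁ p (of c)}) (hsub d hd) (hmin d)
    exact (Set.ext_iff.1 this e).2 he
  obtain ⟨n₂, i₂, ρ₂, hr₂, hinj₂, hρ₂⟩ :=
    exists_restriction (power ρ₁ p) {d | d ∈ power ρ₁ p (of c)} (Set.toFinite _) hsub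
  have hmem : ∀ k, i₂ k ∈ power ρ₁ p (of c) := fun k =>
    (Set.ext_iff.1 hr₂ _).1 (Set.mem_range_self k)
  have hprim : ∀ b c, b ∈ ρ₂ (of c) := by
    intro b k
    have h1 := heq _ (hmem k) _ (hmem b)
    rw [← map_of, hρ₂, mem_map] at h1
    obtain ⟨b', hb', he⟩ := h1
    rwa [← hinj₂ he]
  have hs₂ : ∀ k, Stays L ρ₂ ((h.comp (map i₁)).comp (map i₂)) (of k) := fun k =>
    (stays_comp_iff hρ₂ _ _).2 ((hs₁ _).power p)
  have hg₂ : ∀ k, Grows ρ₂ ((h.comp (map i₁)).comp (map i₂)) (of k) := fun k =>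
    (grows_comp_iff hρ₂ _ _).2 ((hg₁ _).power hp)
  have : Nonempty (Fin n₂) := by
    obtain ⟨d, hd⟩ := ne_one_iff_exists_mem.1 ((hg₁ c).power hp).ne_one
    obtain ⟨k, -⟩ : d ∈ Set.range i₂ := (Set.ext_iff.1 hr₂ d).2 hd
    exact ⟨k⟩
  obtain ⟨q, hq, a, u, hu⟩ := exists_power_prolongable fun k => (hg₂ k).ne_one
  exact ⟨n₂, power ρ₂ q, _, a, u, ⟨1, le_rfl, fun b c => mem_power_of_forall_mem hprim hq b c⟩, hu,
    (hs₂ a).power q, (hg₂ a).power hq⟩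

/-! ### Erased letters and letters with finite orbits -/

theorem length_le_length_hom {A B : Type*} {f : FreeMonoid A →* FreeMonoid B} {w : FreeMonoid A}
    (hf : ∀ c ∈ w, f (of c) ≠ 1) : w.length ≤ (f w).length := by
  induction w using FreeMonoid.inductionOn' with
  | one => exact Nat.zero_le _
  | of_mul c w ih =>
    have h1 := ih fun d hd => hf d (mem_mul.2 (Or.inr hd))
    have h2 : (f (of c)).length ≠ 0 := fun h =>
      hf c (mem_mul.2 (Or.inl mem_of_self)) (length_eq_zero.1 h)
    rw [map_mul, length_mul, length_mul, length_of]
    omega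

section

variable {A B : Type*} {L : Set (FreeMonoid B)} {φ : FreeMonoid A →* FreeMonoid A}
  {h : FreeMonoid A →* FreeMonoid B}

theorem Stays.comp {w : FreeMonoid A} (hs : Stays L φ h w) : Stays L φ (h.comp φ) w := by
  intro n
  rw [MonoidHom.comp_apply, ← Function.iterate_succ_apply' φ]
  exact hs _

theorem Grows.comp {w : FreeMonoid A} (hs : Grows φ h w) : Grows φ (h.comp φ) w := by
  intro N
  obtain ⟨n₀, hn⟩ := hs N
  refine ⟨n₀, fun n hn' => ?_⟩
  rw [MonoidHom.comp_apply, ← Function.iterate_succ_apply' φ]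
  exact hn _ (by omega)

theorem Grows.of_iterate {w : FreeMonoid A} {m : ℕ} (hs : Grows φ h (φ^[m] w)) :
    Grows φ h w := by
  intro N
  obtain ⟨n₀, hn⟩ := hs N
  refine ⟨n₀ + m, fun n hn' => ?_⟩
  obtain ⟨r, rfl⟩ := Nat.exists_eq_add_of_le' (show m ≤ n by omega)
  rw [Function.iterate_add_apply]
  exact hn _ (by omega)

theorem finite_setOf_length_le (A : Type*) [Finite A] (N : ℕ) :
    {w : FreeMonoid A | w.length ≤ N}.Finite :=
  List.finite_length_le A N

end

/-- After passing to a power and deleting letters with empty images, each letter has a finite orbit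
or grows. -/
theorem exists_finite_orbit_or_grows {A B : Type*} [Finite A] {L : Set (FreeMonoid B)}
    {φ : FreeMonoid A →* FreeMonoid A} {h : FreeMonoid A →* FreeMonoid B}
    (hs : ∀ c, Stays L φ h (of c)) {a : A} (ha : Grows φ h (of a)) :
    ∃ (ψ : FreeMonoid A →* FreeMonoid A) (h' : FreeMonoid A →* FreeMonoid B),
      (∀ c, Stays L ψ h' (of c)) ∧ Grows ψ h' (of a) ∧
        ∀ c, (Set.range fun n => ψ^[n] (of c)).Finite ∨ Grows ψ h' (of c) := by
  classical
  obtain ⟨p, hp, hidem⟩ := exists_power_mem_idempotent φ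
  set ψ := power φ p
  set k : FreeMonoid A →* FreeMonoid B := h.comp ψ with hk
  -- Whether `h` erases a word depends only on its set of letters, and `ψ (ψ c)` has the same
  -- letters as `ψ c`.
  have hkψ : ∀ c, k (ψ (of c)) = 1 ↔ k (of c) = 1 := by
    intro c
    rw [hk, MonoidHom.comp_apply, MonoidHom.comp_apply, hom_eq_one_iff h, hom_eq_one_iff h]
    simp only [hidem]
  let δ : FreeMonoid A →* FreeMonoid A := lift fun c => if k (of c) = 1 then 1 else of c
  have hδ : ∀ c, δ (of c) = if k (of c) = 1 then 1 else of c := fun c => lift_eval_of _ c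
  have hkδ : ∀ w, k (δ w) = k w := by
    intro w
    have : k.comp δ = k := hom_eq fun c => by
      rw [MonoidHom.comp_apply, hδ]
      split_ifs with hc
      · rw [hc, map_one]
      · rfl
    exact DFunLike.congr_fun this w
  let θ := δ.comp ψ
  have hθ : ∀ w, θ (δ w) = δ (ψ w) := by
    intro w
    have : θ.comp δ = δ.comp ψ := hom_eq fun c => by
      rw [MonoidHom.comp_apply, MonoidHom.comp_apply, hδ]
      split_ifs with hc
      · change θ 1 = δ (ψ (of c))
        rw [map_one θ, eq_comm, hom_eq_one_iff δ]
        intro d hd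
        rw [hδ, if_pos ((hom_eq_one_iff k).1 ((hkψ c).2 hc) d hd)]
      · rfl
    exact DFunLike.congr_fun this w
  have hiter : ∀ n w, k (θ^[n] w) = k (ψ^[n] w) := by
    intro n w
    cases n with
    | zero => rfl
    | succ n =>
      rw [Function.iterate_succ_apply, Function.iterate_succ_apply]
      change k (θ^[n] (δ (ψ w))) = _
      rw [semiconj_iterate hθ, hkδ]
  -- The shift `n + 1` matters: the starting word may contain letters erased by `k`, and one
  -- application of `θ` deletes them.
  have hmem : ∀ n w, ∀ d ∈ θ^[n + 1] w, k (of d) ≠ 1 := by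
    intro n w d hd
    rw [Function.iterate_succ_apply'] at hd
    obtain ⟨c, -, hc⟩ := (mem_hom_iff δ).1 hd
    rw [hδ] at hc
    split_ifs at hc with h1
    · exact absurd hc notMem_one
    · rwa [mem_of.1 hc]
  -- A surviving letter has a nonempty image under `θ`, so lengths never drop: they are bounded,
  -- giving a finite orbit, or tend to infinity.
  have hmono : ∀ c, Monotone fun n => (θ^[n + 1] (of c)).length := by
    intro c
    refine monotone_nat_of_le_succ fun n => ?_
    rw [Function.iterate_succ_apply' θ (n + 1)]
    refine length_le_length_hom fun d hd h1 => hmem n _ d hd ?_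
    rw [← hkψ, ← hkδ]
    change k (θ (of d)) = 1
    rw [h1, map_one]
  refine ⟨θ, k, fun c n => ?_, fun N => ?_, fun c => ?_⟩
  · rw [hiter]
    exact ((hs c).power p).comp n
  · obtain ⟨n₀, hn⟩ := (ha.power hp).comp N
    refine ⟨n₀, fun n hn' => ?_⟩
    rw [hiter]
    exact hn n hn'
  · by_cases hb : ∃ N, ∀ n, (θ^[n + 1] (of c)).length ≤ N
    · obtain ⟨N, hN⟩ := hb
      refine Or.inl (((finite_setOf_length_le A N).insert (of c)).subset ?_)
      rintro _ ⟨n, rfl⟩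
      cases n with
      | zero => exact Set.mem_insert _ _
      | succ n => exact Set.mem_insert_of_mem _ (hN n)
    · push Not at hb
      refine Or.inr fun N => ?_
      obtain ⟨n₀, hn⟩ := hb N
      refine ⟨n₀ + 1, fun n hn' => ?_⟩
      obtain ⟨r, rfl⟩ := Nat.exists_eq_add_of_le' (show 1 ≤ n by omega)
      exact (hn.le.trans (hmono c (show n₀ ≤ r by omega))).trans
        (length_le_length_hom (hmem r _))

/-- A morphism over growing letters `G` and letters `B` that it fixes. -/
structure IsGrowing {G B : Type*} (L : Set (FreeMonoid B))
    (ψ : FreeMonoid (G ⊕ B) →* FreeMonoid (G ⊕ B)) (h : FreeMonoid (G ⊕ B) →* FreeMonoid B) :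
    Prop where
  map_inr : ∀ b, ψ (of (Sum.inr b)) = of (Sum.inr b)
  hom_inr : ∀ b, h (of (Sum.inr b)) = of b
  stays : ∀ s, Stays L ψ h (of (Sum.inl s))
  grows : ∀ s, Grows ψ h (of (Sum.inl s))

/-- Letters with finite orbits can be replaced by their images. -/
theorem exists_isGrowing {A B : Type*} [Finite A] {L : Set (FreeMonoid B)}
    {φ : FreeMonoid A →* FreeMonoid A} {h : FreeMonoid A →* FreeMonoid B}
    (hs : ∀ c, Stays L φ h (of c)) {a : A} (ha : Grows φ h (of a))
    (hfin : ∀ c, (Set.range fun n => φ^[n] (of c)).Finite ∨ Grows φ h (of c)) :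
    ∃ (F : Set A) (ψ : FreeMonoid (F ⊕ B) →* FreeMonoid (F ⊕ B))
      (h' : FreeMonoid (F ⊕ B) →* FreeMonoid B), Nonempty F ∧ IsGrowing L ψ h' := by
  classical
  let F : Set A := {c | Grows φ h (of c)}
  obtain ⟨p, hp, hidem⟩ : ∃ p, 1 ≤ p ∧ ∀ c ∉ F, power φ p (power φ p (of c)) = power φ p (of c) := by
    -- All letters with finite orbits are iterated together, so that one exponent serves them all.
    let f : ((Fᶜ : Set A) → FreeMonoid A) → ((Fᶜ : Set A) → FreeMonoid A) := fun S c => φ (S c)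
    have hf : ∀ n c, (f^[n] fun c => of c.1) c = φ^[n] (of c.1) := by
      intro n
      induction n with
      | zero => exact fun c => rfl
      | succ n ih =>
        intro c
        rw [Function.iterate_succ_apply', Function.iterate_succ_apply', ← ih]
    obtain ⟨p, hp, he⟩ := exists_iterate_idempotent f (fun c => of c.1) (by
      refine (Set.Finite.pi' fun c : (Fᶜ : Set A) => (hfin c).resolve_right c.2).subset ?_
      rintro _ ⟨n, rfl⟩ c
      exact ⟨n, (hf n c).symm⟩)
    refine ⟨p, hp, fun c hc => ?_⟩
    have h1 := congrFun he ⟨c, hc⟩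
    rwa [← Function.iterate_add_apply, hf, hf, Function.iterate_add_apply] at h1
  set ψ := power φ p
  -- With `h.comp ψ` in place of `h`, a letter outside `F` and its image under `ψ` have the same
  -- code, so that code can be treated as fixed.
  let k : FreeMonoid A →* FreeMonoid B := h.comp ψ
  let τ : FreeMonoid A →* FreeMonoid (F ⊕ B) := lift fun c =>
    if hc : c ∈ F then of (Sum.inl ⟨c, hc⟩) else map Sum.inr (k (of c))
  have hτ₁ : ∀ c (hc : c ∈ F), τ (of c) = of (Sum.inl ⟨c, hc⟩) := fun c hc =>
    (lift_eval_of _ c).trans (dif_pos hc)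
  have hτ₂ : ∀ c ∉ F, τ (of c) = map Sum.inr (k (of c)) := fun c hc =>
    (lift_eval_of _ c).trans (dif_neg hc)
  have hτ₃ : ∀ w, (∀ c ∈ w, c ∉ F) → τ w = map Sum.inr (k w) := by
    intro w
    induction w using FreeMonoid.inductionOn' with
    | one => simp
    | of_mul c w ih =>
      intro hw
      rw [map_mul, map_mul, map_mul, ih fun d hd => hw d (mem_mul.2 (Or.inr hd)),
        hτ₂ c (hw c (mem_mul.2 (Or.inl mem_of_self)))]
  let ψ' : FreeMonoid (F ⊕ B) →* FreeMonoid (F ⊕ B) :=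
    lift (Sum.elim (fun s => τ (ψ (of s.1))) fun b => of (Sum.inr b))
  let h' : FreeMonoid (F ⊕ B) →* FreeMonoid B :=
    lift (Sum.elim (fun s => k (of s.1)) of)
  have hinr : ∀ v : FreeMonoid B, ψ' (map Sum.inr v) = map Sum.inr v := by
    intro v
    have : ψ'.comp (map Sum.inr) = map Sum.inr := hom_eq fun b => rfl
    exact DFunLike.congr_fun this v
  have hinr' : ∀ v : FreeMonoid B, h' (map Sum.inr v) = v := by
    intro v
    have : h'.comp (map Sum.inr) = MonoidHom.id _ := hom_eq fun b => rfl
    exact DFunLike.congr_fun this v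
  have hsemi : ∀ w, ψ' (τ w) = τ (ψ w) := by
    intro w
    have : ψ'.comp τ = τ.comp ψ := hom_eq fun c => by
      rw [MonoidHom.comp_apply, MonoidHom.comp_apply]
      by_cases hc : c ∈ F
      · rw [hτ₁ c hc]
        rfl
      · rw [hτ₂ c hc, hinr, hτ₃]
        · change map Sum.inr (h (ψ (of c))) = map Sum.inr (h (ψ (ψ (of c))))
          rw [hidem c hc]
        · exact fun d hd hdF => hc (Grows.of_iterate (m := p) (Grows.of_mem hd hdF))
    exact DFunLike.congr_fun this w
  have hk : k = h'.comp τ := hom_eq fun c => by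
    change k (of c) = h' (τ (of c))
    by_cases hc : c ∈ F
    · rw [hτ₁ c hc]
      rfl
    · rw [hτ₂ c hc, hinr']
  refine ⟨F, ψ', h', ⟨⟨a, ha⟩⟩, fun b => rfl, fun b => rfl, fun s => ?_, fun s => ?_⟩
  · have := ((hs s.1).power p).comp
    rw [← hτ₁ s.1 s.2, ← stays_comp_iff hsemi, ← hk]
    exact this
  · have := (Grows.power (show Grows φ h (of s.1) from s.2) hp).comp
    rw [← hτ₁ s.1 s.2, ← grows_comp_iff hsemi, ← hk]
    exact this

/-! ### Normalising the ends of images of growing letters -/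

section Decomposition

variable {G B : Type*}

theorem eq_map_inr_or_exists_first (w : FreeMonoid (G ⊕ B)) :
    (∃ v, w = map Sum.inr v) ∨ ∃ v s x, w = map Sum.inr v * of (Sum.inl s) * x := by
  induction w using FreeMonoid.inductionOn' with
  | one => exact Or.inl ⟨1, rfl⟩
  | of_mul c w ih =>
    rcases c with s | b
    · exact Or.inr ⟨1, s, w, by rw [map_one, one_mul]⟩
    · rcases ih with ⟨v, rfl⟩ | ⟨v, s, x, rfl⟩
      · exact Or.inl ⟨of b * v, rfl⟩
      · exact Or.inr ⟨of b * v, s, x, by rw [map_mul, map_of]; simp only [mul_assoc]⟩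

theorem eq_map_inr_or_exists_last (w : FreeMonoid (G ⊕ B)) :
    (∃ v, w = map Sum.inr v) ∨ ∃ y s v, w = y * of (Sum.inl s) * map Sum.inr v := by
  induction w using FreeMonoid.inductionOn' with
  | one => exact Or.inl ⟨1, rfl⟩
  | of_mul c w ih =>
    rcases ih with ⟨v, rfl⟩ | ⟨y, s, v, rfl⟩
    · rcases c with s | b
      · exact Or.inr ⟨1, s, v, by rw [one_mul]⟩
      · exact Or.inl ⟨of b * v, rfl⟩
    · exact Or.inr ⟨of c * y, s, v, by simp only [mul_assoc]⟩

end Decomposition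

theorem exists_iterate_comp_idempotent {G : Type*} [Finite G] (f : G → G) :
    ∃ p, 1 ≤ p ∧ ∀ s, f^[p] (f^[p] s) = f^[p] s := by
  have hf : ∀ n, (fun g : G → G => f ∘ g)^[n] id = f^[n] := by
    intro n
    induction n with
    | zero => rfl
    | succ n ih => rw [Function.iterate_succ_apply', ih, Function.iterate_succ']
  obtain ⟨p, hp, he⟩ := exists_iterate_idempotent (fun g : G → G => f ∘ g) id (Set.toFinite _)
  refine ⟨p, hp, fun s => ?_⟩
  rw [← Function.iterate_add_apply, hf, hf] at he
  rw [← Function.iterate_add_apply, he]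

namespace IsGrowing

variable {G B : Type*} {L : Set (FreeMonoid B)} {ψ : FreeMonoid (G ⊕ B) →* FreeMonoid (G ⊕ B)}
  {h : FreeMonoid (G ⊕ B) →* FreeMonoid B}

theorem map_inr_word (hψ : IsGrowing L ψ h) (v : FreeMonoid B) :
    ψ (map Sum.inr v) = map Sum.inr v := by
  have : ψ.comp (map Sum.inr) = map Sum.inr := hom_eq fun b => hψ.map_inr b
  exact DFunLike.congr_fun this v

theorem iterate_inr_word (hψ : IsGrowing L ψ h) (n : ℕ) (v : FreeMonoid B) :
    ψ^[n] (map Sum.inr v) = map Sum.inr v :=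
  Function.iterate_fixed (hψ.map_inr_word v) n

theorem hom_inr_word (hψ : IsGrowing L ψ h) (v : FreeMonoid B) : h (map Sum.inr v) = v := by
  have : h.comp (map Sum.inr) = MonoidHom.id _ := hom_eq fun b => hψ.hom_inr b
  exact DFunLike.congr_fun this v

theorem power (hψ : IsGrowing L ψ h) {p : ℕ} (hp : 1 ≤ p) : IsGrowing L (power ψ p) h where
  map_inr b := hψ.iterate_inr_word p (of b)
  hom_inr := hψ.hom_inr
  stays s := (hψ.stays s).power p
  grows s := (hψ.grows s).power hp

theorem map_inl_ne (hψ : IsGrowing L ψ h) (s : G) (v : FreeMonoid B) :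
    ψ (of (Sum.inl s)) ≠ map Sum.inr v := by
  intro hv
  refine (hψ.grows s).not_eventually_constant 1 (map Sum.inr v) fun n hn => ?_
  obtain ⟨r, rfl⟩ := Nat.exists_eq_add_of_le' hn
  rw [Function.iterate_succ_apply, hv, hψ.iterate_inr_word]

theorem exists_first (hψ : IsGrowing L ψ h) (s : G) :
    ∃ v t x, ψ (of (Sum.inl s)) = map Sum.inr v * of (Sum.inl t) * x :=
  (eq_map_inr_or_exists_first _).resolve_left fun ⟨v, hv⟩ => hψ.map_inl_ne s v hv

theorem exists_last (hψ : IsGrowing L ψ h) (s : G) :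
    ∃ y t v, ψ (of (Sum.inl s)) = y * of (Sum.inl t) * map Sum.inr v :=
  (eq_map_inr_or_exists_last _).resolve_left fun ⟨v, hv⟩ => hψ.map_inl_ne s v hv

/-- The `n`-th iterate of `s` begins with `v ^ n`, which `h` recovers unchanged, so every power of
`v` lies in `L`. -/
theorem head_eq_one (hψ : IsGrowing L ψ h) (hL : FactorClosed L) (hp : PowerFree L) {s : G}
    {v : FreeMonoid B} {x : FreeMonoid (G ⊕ B)}
    (hs : ψ (of (Sum.inl s)) = map Sum.inr v * of (Sum.inl s) * x) : v = 1 := by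
  have hpow : ∀ n : ℕ, ∃ y, ψ^[n] (of (Sum.inl s)) = map Sum.inr (v ^ n) * y := by
    intro n
    induction n with
    | zero => exact ⟨of (Sum.inl s), by simp⟩
    | succ n ih =>
      obtain ⟨y, hy⟩ := ih
      refine ⟨y * ψ^[n] x, ?_⟩
      rw [Function.iterate_succ_apply, hs, iterate_mul, iterate_mul, hψ.iterate_inr_word, hy,
        pow_succ', map_mul]
      simp only [mul_assoc]
  refine hp v fun n => ?_
  obtain ⟨y, hy⟩ := hpow n
  have := hψ.stays s n
  rw [hy, map_mul, hψ.hom_inr_word] at this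
  exact hL 1 _ (h y) (by rwa [one_mul])

theorem tail_eq_one (hψ : IsGrowing L ψ h) (hL : FactorClosed L) (hp : PowerFree L) {s : G}
    {v : FreeMonoid B} {x : FreeMonoid (G ⊕ B)}
    (hs : ψ (of (Sum.inl s)) = x * of (Sum.inl s) * map Sum.inr v) : v = 1 := by
  have hpow : ∀ n : ℕ, ∃ y, ψ^[n] (of (Sum.inl s)) = y * map Sum.inr (v ^ n) := by
    intro n
    induction n with
    | zero => exact ⟨of (Sum.inl s), by simp⟩
    | succ n ih =>
      obtain ⟨y, hy⟩ := ih
      refine ⟨ψ^[n] x * y, ?_⟩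
      rw [Function.iterate_succ_apply, hs, iterate_mul, iterate_mul, hψ.iterate_inr_word, hy,
        pow_succ, map_mul]
      simp only [mul_assoc]
  refine hp v fun n => ?_
  obtain ⟨y, hy⟩ := hpow n
  have := hψ.stays s n
  rw [hy, map_mul, hψ.hom_inr_word] at this
  exact hL (h y) _ 1 (by rwa [mul_one])

/-- After conjugation, the image of each growing letter begins with a growing letter. -/
theorem exists_conjugate [Finite G] (hψ : IsGrowing L ψ h) (hL : FactorClosed L)
    (hp : PowerFree L) :
    ∃ (ψ' : FreeMonoid (G ⊕ B) →* FreeMonoid (G ⊕ B)) (h' : FreeMonoid (G ⊕ B) →* FreeMonoid B),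
      IsGrowing L ψ' h' ∧ ∀ s, ∃ t x, ψ' (of (Sum.inl s)) = of (Sum.inl t) * x := by
  choose v₀ f₀ x₀ h₀ using hψ.exists_first
  have hiter : ∀ n s, ∃ v x,
      ψ^[n] (of (Sum.inl s)) = map Sum.inr v * of (Sum.inl (f₀^[n] s)) * x := by
    intro n s
    induction n with
    | zero => exact ⟨1, 1, by simp⟩
    | succ n ih =>
      obtain ⟨v, x, hx⟩ := ih
      refine ⟨v * v₀ (f₀^[n] s), x₀ (f₀^[n] s) * ψ x, ?_⟩
      rw [Function.iterate_succ_apply', hx, map_mul, map_mul, hψ.map_inr_word, h₀,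
        Function.iterate_succ_apply', map_mul]
      simp only [mul_assoc]
  obtain ⟨p, hp₁, hidem⟩ := exists_iterate_comp_idempotent f₀
  choose v x hx using hiter p
  have hχ := hψ.power hp₁
  set χ := MorphicWords.power ψ p
  set f := f₀^[p]
  replace hx : ∀ s, χ (of (Sum.inl s)) = map Sum.inr (v s) * of (Sum.inl (f s)) * x s := hx
  have hv : ∀ s, v (f s) = 1 := by
    intro s
    refine hχ.head_eq_one hL hp (x := x (f s)) (s := f s) ?_
    rw [hx, hidem]
  -- `θ` attaches to `s` the fixed word that leads its image, and `ψ'` omits that word, so that `ψ'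
  -- ∘ θ = θ ∘ χ`. Because `v (f s) = 1`, `θ` adds nothing before `f s`.
  let θ : FreeMonoid (G ⊕ B) →* FreeMonoid (G ⊕ B) :=
    lift (Sum.elim (fun s => map Sum.inr (v s) * of (Sum.inl s)) fun b => of (Sum.inr b))
  let ψ' : FreeMonoid (G ⊕ B) →* FreeMonoid (G ⊕ B) :=
    lift (Sum.elim (fun s => θ (of (Sum.inl (f s)) * x s)) fun b => of (Sum.inr b))
  let h' : FreeMonoid (G ⊕ B) →* FreeMonoid B :=
    lift (Sum.elim (fun s => h (of (Sum.inl (f s)) * x s)) of)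
  have hθinl : ∀ s, θ (of (Sum.inl s)) = map Sum.inr (v s) * of (Sum.inl s) := fun s => rfl
  have hθinr : ∀ u : FreeMonoid B, θ (map Sum.inr u) = map Sum.inr u := fun u =>
    DFunLike.congr_fun (show θ.comp (map Sum.inr) = map Sum.inr from hom_eq fun b => rfl) u
  have hψinr : ∀ u : FreeMonoid B, ψ' (map Sum.inr u) = map Sum.inr u := fun u =>
    DFunLike.congr_fun (show ψ'.comp (map Sum.inr) = map Sum.inr from hom_eq fun b => rfl) u
  have hhinr : ∀ u : FreeMonoid B, h' (map Sum.inr u) = u := fun u =>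
    DFunLike.congr_fun (show h'.comp (map Sum.inr) = MonoidHom.id _ from hom_eq fun b => rfl) u
  have hψinl : ∀ s, ψ' (of (Sum.inl s)) = θ (of (Sum.inl (f s)) * x s) := fun s => rfl
  have hsemi : ∀ w, ψ' (θ w) = θ (χ w) := by
    intro w
    have : ψ'.comp θ = θ.comp χ := hom_eq fun c => by
      rw [MonoidHom.comp_apply, MonoidHom.comp_apply]
      rcases c with s | b
      · rw [hθinl, map_mul, hψinr, hψinl, hx, mul_assoc, map_mul θ (map Sum.inr (v s)), hθinr]
      · rw [hχ.map_inr]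
        rfl
    exact DFunLike.congr_fun this w
  have hh : h'.comp θ = h.comp χ := hom_eq fun c => by
    rw [MonoidHom.comp_apply, MonoidHom.comp_apply]
    rcases c with s | b
    · rw [hθinl, map_mul, hhinr, hx, mul_assoc, map_mul h (map Sum.inr (v s)), hχ.hom_inr_word]
      rfl
    · rw [hχ.map_inr, hχ.hom_inr]
      rfl
  refine ⟨ψ', h', ⟨fun b => rfl, fun b => rfl, fun s => ?_, fun s N => ?_⟩, fun s => ?_⟩
  · have := (hχ.stays s).comp
    rw [← hh, stays_comp_iff hsemi, hθinl, ← mul_one (_ * _)] at this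
    exact this.factor hL
  · have := (hχ.grows s).comp
    rw [← hh, grows_comp_iff hsemi, hθinl] at this
    -- The prefix `v s` is fixed by `ψ'` and contributes a constant length, which is subtracted.
    obtain ⟨n₀, hn⟩ := this ((v s).length + N)
    refine ⟨n₀, fun n hn' => ?_⟩
    have h1 := hn n hn'
    rw [iterate_mul, map_mul, length_mul,
      Function.iterate_fixed (hψinr (v s)) n, hhinr] at h1
    omega
  · refine ⟨f s, θ (x s), ?_⟩
    rw [hψinl, map_mul, hθinl, hv, map_one, one_mul]

/-- After passing to a power, the last growing letter of an image is followed by nothing in its own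
image. -/
theorem exists_power_tail [Finite G] (hψ : IsGrowing L ψ h) (hL : FactorClosed L)
    (hp : PowerFree L) (hst : ∀ s, ∃ t x, ψ (of (Sum.inl s)) = of (Sum.inl t) * x) :
    ∃ ψ' : FreeMonoid (G ⊕ B) →* FreeMonoid (G ⊕ B), IsGrowing L ψ' h ∧
      (∀ s, ∃ t x, ψ' (of (Sum.inl s)) = of (Sum.inl t) * x) ∧
        ∃ (y : G → FreeMonoid (G ⊕ B)) (f : G → G) (v : G → FreeMonoid B),
          (∀ s, ψ' (of (Sum.inl s)) = y s * of (Sum.inl (f s)) * map Sum.inr (v s)) ∧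
            ∀ s, v (f s) = 1 := by
  choose y₀ f₀ v₀ h₀ using hψ.exists_last
  have hiter : ∀ n s, ∃ y v,
      ψ^[n] (of (Sum.inl s)) = y * of (Sum.inl (f₀^[n] s)) * map Sum.inr v := by
    intro n s
    induction n with
    | zero => exact ⟨1, 1, by simp⟩
    | succ n ih =>
      obtain ⟨y, v, hx⟩ := ih
      refine ⟨ψ y * y₀ (f₀^[n] s), v₀ (f₀^[n] s) * v, ?_⟩
      rw [Function.iterate_succ_apply', hx, map_mul, map_mul, hψ.map_inr_word, h₀,
        Function.iterate_succ_apply', map_mul]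
      simp only [mul_assoc]
  obtain ⟨p, hp₁, hidem⟩ := exists_iterate_comp_idempotent f₀
  choose y v hy using hiter p
  have hχ := hψ.power hp₁
  refine ⟨MorphicWords.power ψ p, hχ, fun s => ?_, y, f₀^[p], v, hy, fun s => ?_⟩
  · rw [coe_power]
    clear hy hχ hidem y v
    induction p, hp₁ using Nat.le_induction with
    | base => exact hst s
    | succ p _ ih =>
      obtain ⟨t, x, hx⟩ := ih
      obtain ⟨t', x', hx'⟩ := hst t
      exact ⟨t', x' * ψ x, by rw [Function.iterate_succ_apply', hx, map_mul, hx', mul_assoc]⟩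
  -- By idempotence, the last growing letter of the image of `f₀^[p] s` is that letter itself.
  · refine hχ.tail_eq_one hL hp (x := y (f₀^[p] s)) (s := f₀^[p] s) ?_
    rw [coe_power, hy, hidem]

end IsGrowing

/-! ### Coding by blocks: a growing letter and the fixed word after it -/

section Blocks

variable {G B : Type*}

/-- A letter `(s, v)` spells the growing letter `s` followed by the word `v`. -/
def spell : FreeMonoid (G × FreeMonoid B) →* FreeMonoid (G ⊕ B) :=
  lift fun p => of (Sum.inl p.1) * map Sum.inr p.2

theorem spell_of (s : G) (v : FreeMonoid B) :
    spell (of (s, v)) = of (Sum.inl s) * map Sum.inr v := rfl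

/-- Cut `w` before each growing letter. The length bounds serve to keep the block alphabet finite.
-/
theorem exists_spell (w : FreeMonoid (G ⊕ B)) :
    ∃ v r, w = map Sum.inr v * spell r ∧ v.length ≤ w.length ∧
      ∀ p ∈ r, p.2.length ≤ w.length := by
  induction w using FreeMonoid.inductionOn' with
  | one => exact ⟨1, 1, by simp, le_rfl, fun p hp => absurd hp notMem_one⟩
  | of_mul c w ih =>
    obtain ⟨v, r, hw, hv, hr⟩ := ih
    rw [length_mul, length_of]
    rcases c with s | b
    · refine ⟨1, of (s, v) * r, ?_, Nat.zero_le _, fun p hp => ?_⟩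
      · rw [map_one, one_mul, map_mul, spell_of, mul_assoc, ← hw]
      · rcases mem_mul.1 hp with hp | hp
        · rw [mem_of.1 hp]
          change v.length ≤ _
          omega
        · have := hr p hp
          omega
    · refine ⟨of b * v, r, ?_, ?_, fun p hp => ?_⟩
      · rw [map_mul, map_of, mul_assoc, ← hw]
      · rw [length_mul, length_of]
        omega
      · have := hr p hp
        omega

theorem exists_spell_of_prefix {y z x : FreeMonoid (G ⊕ B)} {t : G}
    (hy : y * z = of (Sum.inl t) * x) :
    ∃ r : FreeMonoid (G × FreeMonoid B), y = spell r ∧ ∀ p ∈ r, p.2.length ≤ y.length := by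
  cases y with
  | one => exact ⟨1, (map_one _).symm, fun p hp => absurd hp notMem_one⟩
  | of_mul c y =>
    have hc : c = Sum.inl t := (List.cons.inj hy).1
    obtain ⟨v, r, hw, hv, hr⟩ := exists_spell y
    rw [length_mul, length_of]
    refine ⟨of (t, v) * r, ?_, fun p hp => ?_⟩
    · rw [map_mul, spell_of, mul_assoc, ← hw, hc]
    · rcases mem_mul.1 hp with hp | hp
      · rw [mem_of.1 hp]
        change v.length ≤ _
        omega
      · have := hr p hp
        omega

/-- The growing letters, each with the fixed letters that follow it, give a primitive morphism. -/
theorem IsGrowing.exists_primitive [Finite G] [Nonempty G] [Finite B] {L : Set (FreeMonoid B)}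
    {ψ : FreeMonoid (G ⊕ B) →* FreeMonoid (G ⊕ B)} {h : FreeMonoid (G ⊕ B) →* FreeMonoid B}
    (hψ : IsGrowing L ψ h) (hL : FactorClosed L)
    (hst : ∀ s, ∃ t x, ψ (of (Sum.inl s)) = of (Sum.inl t) * x)
    {y : G → FreeMonoid (G ⊕ B)} {f : G → G} {v : G → FreeMonoid B}
    (hy : ∀ s, ψ (of (Sum.inl s)) = y s * of (Sum.inl (f s)) * map Sum.inr (v s))
    (hv : ∀ s, v (f s) = 1) :
    ∃ (n : ℕ) (ρ : FreeMonoid (Fin n) →* FreeMonoid (Fin n))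
      (g : FreeMonoid (Fin n) →* FreeMonoid B) (d : Fin n) (u : FreeMonoid (Fin n)),
      IsPrimitive ρ ∧ ρ (of d) = of d * u ∧ Stays L ρ g (of d) ∧ Grows ρ g (of d) := by
  have hr : ∀ s, ∃ r : FreeMonoid (G × FreeMonoid B),
      y s = spell r ∧ ∀ p ∈ r, p.2.length ≤ (y s).length := by
    intro s
    obtain ⟨t, x, hx⟩ := hst s
    rw [hy, mul_assoc] at hx
    exact exists_spell_of_prefix hx
  choose r hr₁ hr₂ using hr
  obtain ⟨N₁, hN₁⟩ := (Set.finite_range fun s => (y s).length).bddAbove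
  obtain ⟨N₂, hN₂⟩ := (Set.finite_range fun s => (v s).length).bddAbove
  replace hN₁ : ∀ s, (y s).length ≤ N₁ := fun s => hN₁ (Set.mem_range_self s)
  replace hN₂ : ∀ s, (v s).length ≤ N₂ := fun s => hN₂ (Set.mem_range_self s)
  -- The block `(s, u)` has image `y s * f s * v s * u`; the trailing `v s` and the old `u` join the
  -- final block.
  let ρ : FreeMonoid (G × FreeMonoid B) →* FreeMonoid (G × FreeMonoid B) :=
    lift fun p => r p.1 * of (f p.1, v p.1 * p.2)
  have hρ : ∀ p, ρ (of p) = r p.1 * of (f p.1, v p.1 * p.2) := fun p => rfl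
  have hsemi : ∀ w, ψ (spell w) = spell (ρ w) := by
    intro w
    have : ψ.comp spell = spell.comp ρ := hom_eq fun p => by
      obtain ⟨s, u⟩ := p
      rw [MonoidHom.comp_apply, MonoidHom.comp_apply, hρ, spell_of, map_mul, map_mul, hy,
        hψ.map_inr_word, spell_of, ← hr₁, map_mul]
      simp only [mul_assoc]
    exact DFunLike.congr_fun this w
  -- The weight `|v s| + |u|` is at most `N₂ + N₁` on blocks inside `y s`, and the final block keeps
  -- the weight of `(s, u)` because `v (f s) = 1`. Hence blocks of bounded weight form a finite set
  -- closed under `ρ`.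
  have hlen : ∀ p, ∀ q ∈ ρ (of p), (v p.1).length + p.2.length ≤ N₁ + N₂ →
      (v q.1).length + q.2.length ≤ N₁ + N₂ := by
    intro p q hq hp
    rw [hρ] at hq
    rcases mem_mul.1 hq with hq | hq
    · have h1 := hr₂ _ q hq
      have h2 := hN₁ p.1
      have h3 := hN₂ q.1
      omega
    · rw [mem_of.1 hq, hv, length_mul, length_one]
      omega
  refine exists_primitive_of_grows ρ (h.comp spell)
    {p | (v p.1).length + p.2.length ≤ N₁ + N₂ ∧ Stays L ρ (h.comp spell) (of p)}
    ?_ ?_ ?_ (fun p hp => hp.2) fun p _ => ?_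
  · refine (Set.finite_univ.prod (finite_setOf_length_le B (N₁ + N₂))).subset fun p hp => ?_
    refine ⟨Set.mem_univ _, ?_⟩
    change p.2.length ≤ N₁ + N₂
    have := hp.1
    omega
  · obtain ⟨s⟩ := ‹Nonempty G›
    refine ⟨(s, 1), ?_, ?_⟩
    · have := hN₂ s
      change (v s).length + 0 ≤ _
      omega
    · rw [stays_comp_iff hsemi, spell_of, map_one, mul_one]
      exact hψ.stays s
  · intro p hp q hq
    exact ⟨hlen p q hq hp.1, (hp.2.iterate 1).of_mem hL hq⟩
  · rw [grows_comp_iff hsemi, spell_of, ← one_mul (of (Sum.inl _))]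
    exact (hψ.grows _).factor

end Blocks

end MorphicWords

/-! ### Assembly -/

theorem mainTheorem5 {A B : Type*} [Finite A] [Finite B]
    (φ : FreeMonoid A →* FreeMonoid A) (h : FreeMonoid A →* FreeMonoid B) (a : A)
    (X : ℕ → A) (hX : MorphicWords.IsPureMorphic φ a X)
    (W : ℕ → B) (hW : MorphicWords.IsImage h X W)
    (hper : ¬ MorphicWords.IsPeriodic W) (hrec : MorphicWords.UniformlyRecurrent W) :
    ∃ (D : Type) (_ : Finite D) (ρ : FreeMonoid D →* FreeMonoid D)
      (g : FreeMonoid D →* FreeMonoid B) (d : D) (Y : ℕ → D) (V : ℕ → B),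
      MorphicWords.IsPrimitive ρ ∧ MorphicWords.IsPureMorphic ρ d Y ∧
        MorphicWords.IsImage g Y V ∧
        MorphicWords.factors V = MorphicWords.factors W := by
  open MorphicWords FreeMonoid in
  have hL := factorClosed_factors W
  have hP := powerFree_factors hrec hper
  have ha := grows_of_isImage hX hW
  -- The letters whose coded iterates stay in `L` are closed under `φ` and include `a`, because the
  -- coded iterates of `a` are prefixes of `W`.
  obtain ⟨n, i, φ₁, hr, -, hφ₁⟩ := exists_restriction φ {c | Stays (factors W) φ h (of c)}
    (Set.toFinite _) fun c hc d hd => (Stays.iterate hc 1).of_mem hL hd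
  obtain ⟨a₁, rfl⟩ : a ∈ Set.range i := hr ▸ stays_factors hX hW
  have hs₁ : ∀ k, Stays (factors W) φ₁ (h.comp (map i)) (of k) := fun k =>
    (stays_comp_iff hφ₁ h _).2 ((Set.ext_iff.1 hr _).1 (Set.mem_range_self k))
  obtain ⟨φ₂, h₂, hs₂, ha₂, hfin⟩ :=
    exists_finite_orbit_or_grows hs₁ ((grows_comp_iff hφ₁ h (of a₁)).2 ha)
  obtain ⟨F, φ₃, h₃, hne, hg₃⟩ := exists_isGrowing hs₂ ha₂ hfin
  obtain ⟨φ₄, h₄, hg₄, hst₄⟩ := hg₃.exists_conjugate hL hP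
  obtain ⟨φ₅, hg₅, hst₅, y, f, v, hy, hv⟩ := hg₄.exists_power_tail hL hP hst₄
  obtain ⟨m, ρ, g, d, u, hprim, hu, hs, hg⟩ := hg₅.exists_primitive hL hst₅ hy hv
  obtain ⟨Y, V, hY, hV⟩ := exists_isPureMorphic hu hg
  exact ⟨Fin m, inferInstance, ρ, g, d, Y, V, hprim, hY, hV, factors_eq_of_stays hrec hY hV hs⟩
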